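/- Let $R=\mathbb{Z}[t]/(t^3)$. A subring of $R$ is understood to contain $1$, and its index is its index as an additive subgroup. For a subring $S\subseteq R$ of finite index there are unique positive integers $\alpha_1,\alpha_2,\alpha_3$ with $\alpha_3\mid\alpha_2\mid\alpha_1$ and $R/S\cong \mathbb{Z}/\alpha_1\mathbb{Z}\oplus\mathbb{Z}/\alpha_2\mathbb{Z}\oplus\mathbb{Z}/\alpha_3\mathbb{Z}$ as abelian groups; the corank of $S$ is the largest $i$ with $\alpha_i\neq 1$ (and $0$ if there is none), and $S$ is called cocyclic if its corank is $0$ or $1$. For $n\ge 1$ let $a_n$ be the number of subrings of $R$ of index $n$, and $a_n^{\mathrm{cyclic}}$ the number of those that are cocyclic; these numbers are finite. Then the product $\prod_p(1-3p^{-2}+2p^{-3})$ over all primes $p$ converges, and \[ \sum_{n\le B} a_n^{\mathrm{cyclic}} \sim C\,B(\ln B)^2\quad (B\to\infty),\qquad C=\frac{1}{12}\prod_p\left(1-3p^{-2}+2p^{-3}\right). \] Moreover, the proportion of cocyclic subrings among all subrings satisfies \[ \lim_{B\to\infty}\frac{\sum_{n\le B} a_n^{\mathrm{cyclic}}}{\sum_{n\le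 B} a_n}=\zeta(2)\prod_p\left(1-3p^{-2}+2p^{-3}\right), \] where $\zeta$ is the Riemann zeta function. -/

import Mathlib

namespace CocyclicSubrings

/-- The ring `ℤ[t]/(t^3)`. -/
abbrev R : Type := Polynomial ℤ ⧸ Ideal.span {(Polynomial.X : Polynomial ℤ) ^ 3}

/-- `α = (α₁, …, αₙ)` is the cotype of the finite-index subgroup `Λ` of `A` (with `A` free abelian
of rank `n`): the `αᵢ` are positive integers, `αᵢ₊₁ ∣ αᵢ`, and
`A / Λ ≅ ℤ/α₁ ⊕ ⋯ ⊕ ℤ/αₙ`. The entry `αᵢ` is `α (i - 1)`, as `Fin n` starts at `0`. -/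
def IsCotype {A : Type*} [AddCommGroup A] {n : ℕ} (Λ : AddSubgroup A) (α : Fin n → ℕ) : Prop :=
  (∀ i, 0 < α i) ∧ (∀ i j, i ≤ j → α j ∣ α i) ∧ Nonempty ((A ⧸ Λ) ≃+ (∀ i, ZMod (α i)))

/-- The largest index `i ∈ {1, …, n}` with `αᵢ ≠ 1`, and `0` if there is none. -/
def corank {n : ℕ} (α : Fin n → ℕ) : ℕ :=
  (Finset.univ.filter fun i : Fin n => α i ≠ 1).sup fun i => (i : ℕ) + 1

/-- A (unital) subring of `ℤ[t]/(t^3)`, a free abelian group of rank `3`, is cocyclic if its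
additive group has finite index and corank `0` or `1`. -/
def IsCocyclic (S : Subring R) : Prop :=
  ∃ α : Fin 3 → ℕ, IsCotype S.toAddSubgroup α ∧ corank α ≤ 1

/-- The subrings of `ℤ[t]/(t^3)` of additive index `n` (meaningful for `n ≥ 1`;
Mathlib gives infinite index the value `0`). -/
def subringsOfIndex (n : ℕ) : Set (Subring R) :=
  {S | S.toAddSubgroup.index = n}

/-- The number of subrings of index `n`. -/
noncomputable def a (n : ℕ) : ℕ := (subringsOfIndex n).ncard

/-- The number of cocyclic subrings of index `n`. -/
noncomputable def aCyclic (n : ℕ) : ℕ := {S ∈ subringsOfIndex n | IsCocyclic S}.ncard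

/-- The number of subrings of index at most `B`. -/
noncomputable def N (B : ℝ) : ℕ := ∑ n ∈ Finset.Icc 1 ⌊B⌋₊, a n

/-- The number of cocyclic subrings of index at most `B`. -/
noncomputable def NCyclic (B : ℝ) : ℕ := ∑ n ∈ Finset.Icc 1 ⌊B⌋₊, aCyclic n

/-- The Euler factor `1 - 3 p⁻² + 2 p⁻³`. -/
noncomputable def eulerFactor (p : Nat.Primes) : ℝ :=
  1 - 3 * ((p : ℕ) : ℝ)⁻¹ ^ 2 + 2 * ((p : ℕ) : ℝ)⁻¹ ^ 3

end CocyclicSubrings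

/-!
Forgetting the constant term identifies the subrings of `ℤ[t]/(t^3)` of index `n` with the
sublattices of `ℤ t + ℤ t^2` of index `n` whose Hermite normal form `(a, b), (0, d)` satisfies
`d ∣ a^2`. There are `d` choices of `b`, of which the `φ(d)` coprime to `d` are the cocyclic ones.
Writing `d = r s^2` with `r` squarefree turns `d ∣ a^2` into `r s ∣ a`, so that with `a = m r s`
the index is `n = m r^2 s^3`. Hence both counts up to `B` are sums over pairs `(r, s)`, weighted by
`r s^2 ⌊B / (r^2 s^3)⌋`, of a function `μ(r)^2 ∏_{p ∣ r s} (1 - A p)` with `0 ≤ A p ≤ 1 / p`.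
The total weight is `B (log B)^2 / 12 + O(B log B)`. Passing to the pairs with `k ∣ r`, `l ∣ s`
rescales `B` and divides the main term by `k l`, so finitely many primes contribute the product of
their local means, and the remaining primes are negligible because `∑ p⁻²` converges.
-/

namespace CocyclicSubrings

open AddSubgroup

/-! ### Sublattices of `ℤ × ℤ` -/

lemma index_eq_index_comap_inr_mul_index_map_fst {A B : Type*} [AddCommGroup A] [AddCommGroup B]
    (H : AddSubgroup (A × B)) :
    H.index = (H.comap (AddMonoidHom.inr A B)).index * (H.map (AddMonoidHom.fst A B)).index := by
  have hker : (AddMonoidHom.fst A B).ker = (AddMonoidHom.inr A B).range := by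
    ext ⟨x, y⟩
    simp [mem_prod, eq_comm]
  have hfst : (AddMonoidHom.fst A B).range = ⊤ := AddMonoidHom.range_eq_top.2 Prod.fst_surjective
  rw [index_comap, index_map, hfst, index_top, mul_one,
    ← hker, ← relIndex_sup_right, sup_comm H,
    relIndex_mul_index le_sup_right]

lemma eq_zmultiples_index (L : AddSubgroup ℤ) : L = zmultiples (L.index : ℤ) := by
  obtain ⟨g, rfl⟩ := Int.subgroup_cyclic L
  rw [← zmultiples_eq_closure, Int.index_zmultiples, Int.zmultiples_natAbs]

/-- The sublattice of `ℤ × ℤ` spanned by `(a, b)` and `(0, d)`. For `0 < a` and `b < d` this is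
the Hermite normal form of a sublattice of finite index. -/
def hermiteLattice (a b d : ℕ) : AddSubgroup (ℤ × ℤ) :=
  zmultiples ((a, b) : ℤ × ℤ) ⊔ zmultiples ((0, d) : ℤ × ℤ)

section HermiteLattice

variable {a b d : ℕ}

lemma mem_hermiteLattice {x : ℤ × ℤ} :
    x ∈ hermiteLattice a b d ↔ ∃ k : ℤ, x.1 = a * k ∧ (d : ℤ) ∣ x.2 - b * k := by
  obtain ⟨y, z⟩ := x
  simp only [hermiteLattice, mem_sup, mem_zmultiples_iff, exists_exists_eq_and, Prod.smul_mk,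
    smul_eq_mul, mul_zero, Prod.mk_add_mk, add_zero, Prod.mk.injEq, dvd_def, exists_and_left]
  refine exists_congr fun k => ?_
  rw [mul_comm k, eq_comm]
  refine and_congr_right fun _ => exists_congr fun l => ?_
  rw [sub_eq_iff_eq_add', eq_comm, mul_comm k, mul_comm l]

lemma map_fst_hermiteLattice :
    (hermiteLattice a b d).map (AddMonoidHom.fst ℤ ℤ) = zmultiples (a : ℤ) := by
  simp [hermiteLattice, AddSubgroup.map_sup, AddMonoidHom.map_zmultiples]

lemma zero_prod_mem_hermiteLattice (ha : 0 < a) {y : ℤ} :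
    (0, y) ∈ hermiteLattice a b d ↔ (d : ℤ) ∣ y := by
  simp [mem_hermiteLattice, ha.ne']

lemma comap_inr_hermiteLattice (ha : 0 < a) :
    (hermiteLattice a b d).comap (AddMonoidHom.inr ℤ ℤ) = zmultiples (d : ℤ) := by
  ext y
  simp [zero_prod_mem_hermiteLattice ha, Int.mem_zmultiples_iff]

lemma index_hermiteLattice (ha : 0 < a) : (hermiteLattice a b d).index = a * d := by
  rw [index_eq_index_comap_inr_mul_index_map_fst, map_fst_hermiteLattice,
    comap_inr_hermiteLattice ha, Int.index_zmultiples, Int.index_zmultiples, Int.natAbs_natCast,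
    Int.natAbs_natCast, mul_comm]

lemma hermiteLattice_inj {a' b' d' : ℕ} (ha : 0 < a) (ha' : 0 < a') (hb : b < d) (hb' : b' < d')
    (h : hermiteLattice a b d = hermiteLattice a' b' d') : a = a' ∧ b = b' ∧ d = d' := by
  obtain rfl : a = a' := by
    simpa [map_fst_hermiteLattice, Int.index_zmultiples]
      using congrArg (fun H => (H.map (AddMonoidHom.fst ℤ ℤ)).index) h
  obtain rfl : d = d' := by
    simpa [comap_inr_hermiteLattice, ha, Int.index_zmultiples]
      using congrArg (fun H => (H.comap (AddMonoidHom.inr ℤ ℤ)).index) h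
  have hab : ((a, b) : ℤ × ℤ) ∈ hermiteLattice a b' d :=
    h ▸ mem_hermiteLattice.2 ⟨1, by simp, by simp⟩
  obtain ⟨k, hk, hdvd⟩ := mem_hermiteLattice.1 hab
  obtain rfl : k = 1 := by
    simpa [ha.ne', eq_comm] using hk
  have hmod : b' ≡ b [MOD d] := Nat.modEq_iff_dvd.2 (by simpa using hdvd)
  exact ⟨rfl, (hmod.eq_of_lt_of_lt hb' hb).symm, rfl⟩

lemma exists_eq_hermiteLattice {H : AddSubgroup (ℤ × ℤ)} (hH : H.index ≠ 0) :
    ∃ a b d : ℕ, 0 < a ∧ b < d ∧ H = hermiteLattice a b d := by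
  set a := (H.map (AddMonoidHom.fst ℤ ℤ)).index with ha
  set d := (H.comap (AddMonoidHom.inr ℤ ℤ)).index with hd
  rw [index_eq_index_comap_inr_mul_index_map_fst, mul_ne_zero_iff, ← ha, ← hd] at hH
  have hfst : ∀ x, (∃ y, (x, y) ∈ H) ↔ (a : ℤ) ∣ x := fun x => by
    rw [← Int.mem_zmultiples_iff, ha, ← eq_zmultiples_index]; simp
  have hinr : ∀ y, (0, y) ∈ H ↔ (d : ℤ) ∣ y := fun y => by
    rw [← Int.mem_zmultiples_iff, hd, ← eq_zmultiples_index]; simp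
  have hshift : ∀ {x y z : ℤ}, (x, y) ∈ H → ((x, z) ∈ H ↔ (d : ℤ) ∣ z - y) := fun h => Iff.trans
    ⟨fun h' => by simpa using H.sub_mem h' h, fun h' => by simpa using H.add_mem h' h⟩ (hinr _)
  obtain ⟨z, hz⟩ := (hfst a).2 dvd_rfl
  have hd0 : (d : ℤ) ≠ 0 := by exact_mod_cast hH.1
  lift z % d to ℕ using Int.emod_nonneg _ hd0 with b hb
  have hbd : (b : ℤ) < d := hb ▸ Int.emod_lt_of_pos z (by omega)
  have hab : ((a, b) : ℤ × ℤ) ∈ H := (hshift hz).2 <| by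
    rw [hb]
    exact ⟨-(z / d), by linear_combination Int.emod_def z d⟩
  refine ⟨a, b, d, Nat.pos_of_ne_zero hH.2, by exact_mod_cast hbd, ?_⟩
  ext ⟨x, y⟩
  have hmul : ∀ k : ℤ, ((a * k, b * k) : ℤ × ℤ) ∈ H := fun k => by
    simpa [mul_comm] using H.zsmul_mem hab k
  rw [mem_hermiteLattice]
  constructor
  · intro h
    obtain ⟨k, rfl⟩ := (hfst x).1 ⟨y, h⟩
    exact ⟨k, rfl, (hshift (hmul k)).1 h⟩
  · rintro ⟨k, rfl, h⟩
    exact (hshift (hmul k)).2 h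

lemma isAddCyclic_quotient_hermiteLattice_iff (had : ∀ p : ℕ, p.Prime → p ∣ d → p ∣ a) :
    IsAddCyclic ((ℤ × ℤ) ⧸ hermiteLattice a b d) ↔ d.Coprime b := by
  constructor
  · refine fun hcyc => Nat.Coprime.symm (Nat.coprime_of_dvd fun p hp hpb hpd => ?_)
    have : Fact p.Prime := ⟨hp⟩
    let f : ℤ × ℤ →+ ZMod p × ZMod p := (Int.castAddHom _).prodMap (Int.castAddHom _)
    have hf : Function.Surjective f :=
      (ZMod.intCast_surjective (n := p)).prodMap (ZMod.intCast_surjective (n := p))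
    have hle : hermiteLattice a b d ≤ f.ker := by
      simp [hermiteLattice, zmultiples_le, AddMonoidHom.mem_ker, f,
        ZMod.natCast_eq_zero_iff, had p hp hpd, hpb, hpd]
    have hquot : IsAddCyclic (ZMod p × ZMod p) :=
      isAddCyclic_of_surjective (QuotientAddGroup.lift _ f hle)
        (QuotientAddGroup.lift_surjective_of_surjective _ f hf hle)
    have hpp := (AddGroup.isAddCyclic_prod_iff.1 hquot).2.2
    simp [hp.ne_one] at hpp
  · intro hc
    obtain ⟨u, v, huv⟩ : IsCoprime (b : ℤ) d := Nat.isCoprime_iff_coprime.2 hc.symm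
    refine ⟨⟨((1, 0) : ℤ × ℤ), fun x => ?_⟩⟩
    obtain ⟨⟨x, y⟩, rfl⟩ := QuotientAddGroup.mk_surjective x
    refine ⟨x - u * a * y, ?_⟩
    change (x - u * a * y) • (((1, 0) : ℤ × ℤ) : (ℤ × ℤ) ⧸ hermiteLattice a b d) = _
    rw [← QuotientAddGroup.mk_zsmul, QuotientAddGroup.eq, mem_hermiteLattice]
    simp only [Prod.smul_mk, smul_eq_mul, mul_one, mul_zero, Prod.neg_mk, Prod.mk_add_mk]
    exact ⟨u * y, by ring, v * y, by linear_combination - y * huv⟩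

end HermiteLattice

/-! ### Subrings of `ℤ[t]/(t^3)` -/

/-- The coefficient of `t ^ i` in an element of `ℤ[t]/(t^3)`, for `i < 3`. -/
noncomputable def coord (i : Fin 3) : R →+ ℤ :=
  QuotientAddGroup.lift _ (Polynomial.lcoeff ℤ i).toAddMonoidHom fun _ hp =>
    Polynomial.X_pow_dvd_iff.1 (Ideal.mem_span_singleton.1 hp) i i.2

lemma coord_mk (i : Fin 3) (p : Polynomial ℤ) :
    coord i (Ideal.Quotient.mk _ p) = p.coeff i := rfl

lemma coord_intCast (i : Fin 3) (n : ℤ) : coord i n = if i = 0 then n else 0 := by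
  have h : (n : R) = Ideal.Quotient.mk _ (Polynomial.C n) := rfl
  rw [h, coord_mk, Polynomial.coeff_C]
  simp only [Fin.val_eq_zero_iff]

lemma coord_injective : Function.Injective fun (x : R) i => coord i x := by
  intro x y h
  obtain ⟨p, rfl⟩ := Ideal.Quotient.mk_surjective x
  obtain ⟨q, rfl⟩ := Ideal.Quotient.mk_surjective y
  rw [Ideal.Quotient.eq, Ideal.mem_span_singleton, Polynomial.X_pow_dvd_iff]
  intro i hi
  rw [Polynomial.coeff_sub, sub_eq_zero]
  exact congrFun h ⟨i, hi⟩

/-- The pair of coefficients of `t` and `t ^ 2`. Its kernel is `ℤ`, which lies in every subring,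
so a subring is determined by its image under `tail`. -/
noncomputable def tail : R →+ ℤ × ℤ := (coord 1).prod (coord 2)

lemma tail_mk (p : Polynomial ℤ) : tail (Ideal.Quotient.mk _ p) = (p.coeff 1, p.coeff 2) := rfl

lemma tail_surjective : Function.Surjective tail := fun ⟨y, z⟩ =>
  ⟨Ideal.Quotient.mk _ (Polynomial.C y * Polynomial.X + Polynomial.C z * Polynomial.X ^ 2), by
    rw [tail_mk]
    simp [-eq_intCast]⟩

lemma tail_one : tail 1 = 0 :=
  (tail_mk 1).trans (by simp [Polynomial.coeff_one])

lemma tail_mul (x y : R) :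
    tail (x * y) = coord 0 x • tail y + coord 0 y • tail x + (0, (tail x).1 * (tail y).1) := by
  obtain ⟨p, rfl⟩ := Ideal.Quotient.mk_surjective x
  obtain ⟨q, rfl⟩ := Ideal.Quotient.mk_surjective y
  have hcoeff : (p * q).coeff 2
      = p.coeff 0 * q.coeff 2 + p.coeff 1 * q.coeff 1 + p.coeff 2 * q.coeff 0 := by
    rw [Polynomial.coeff_mul, Finset.Nat.sum_antidiagonal_eq_sum_range_succ_mk]
    simp [Finset.sum_range_succ]
  simp only [← map_mul, tail_mk, coord_mk, Polynomial.mul_coeff_one, hcoeff, Fin.val_zero,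
    Prod.smul_mk, smul_eq_mul, Prod.mk_add_mk, add_zero, Prod.mk.injEq]
  constructor <;> ring

lemma ker_tail_le (S : Subring R) : tail.ker ≤ S.toAddSubgroup := by
  intro x hx
  have h : x = (coord 0 x : R) := coord_injective <| funext fun i => by
    change coord i x = coord i (coord 0 x : R)
    rw [coord_intCast]
    fin_cases i
    exacts [rfl, congrArg Prod.fst hx, congrArg Prod.snd hx]
  exact h ▸ intCast_mem S _

/-- The condition on a sublattice `H` of `ℤ t + ℤ t ^ 2` for `ℤ + H` to be a subring of
`ℤ[t]/(t^3)`, where `(y t + z t ^ 2) (y' t + z' t ^ 2) = y y' t ^ 2`. -/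
def IsMulClosed (H : AddSubgroup (ℤ × ℤ)) : Prop :=
  ∀ x ∈ H, ∀ y ∈ H, (0, x.1 * y.1) ∈ H

lemma isMulClosed_map_tail (S : Subring R) : IsMulClosed (S.toAddSubgroup.map tail) := by
  rintro _ ⟨x, hx, rfl⟩ _ ⟨y, hy, rfl⟩
  refine ⟨x * y - coord 0 x • y - coord 0 y • x, ?_, by
    simp only [map_sub, map_zsmul, tail_mul]; abel⟩
  exact S.sub_mem (S.sub_mem (S.mul_mem hx hy) (S.zsmul_mem hy _)) (S.zsmul_mem hx _)

/-- The subring `ℤ + H` of `ℤ[t]/(t^3)`, for a sublattice `H` of `ℤ t + ℤ t ^ 2`. -/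
noncomputable def subringOfTail (H : AddSubgroup (ℤ × ℤ)) (hH : IsMulClosed H) : Subring R where
  __ := H.comap tail
  one_mem' := by simp [tail_one]
  mul_mem' {x y} hx hy := by
    change tail (x * y) ∈ H
    rw [tail_mul]
    exact H.add_mem (H.add_mem (H.zsmul_mem hy _) (H.zsmul_mem hx _)) (hH _ hx _ hy)

lemma bijOn_map_tail (n : ℕ) :
    Set.BijOn (fun S : Subring R => S.toAddSubgroup.map tail) (subringsOfIndex n)
      {H | H.index = n ∧ IsMulClosed H} := by
  refine ⟨fun S hS => ⟨?_, isMulClosed_map_tail S⟩, fun S _ T _ hST => ?_, fun H hH => ?_⟩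
  · rw [index_map_eq _ tail_surjective (ker_tail_le S)]
    exact hS
  · apply Subring.toAddSubgroup_injective
    rw [← comap_map_eq_self (ker_tail_le S), ← comap_map_eq_self (ker_tail_le T)]
    exact congrArg (comap tail) hST
  · have hmap : (subringOfTail H hH.2).toAddSubgroup.map tail = H :=
      map_comap_eq_self_of_surjective tail_surjective H
    refine ⟨subringOfTail H hH.2, ?_, hmap⟩
    change (H.comap tail).index = n
    rw [index_comap_of_surjective _ tail_surjective, hH.1]

lemma isMulClosed_hermiteLattice_iff {a b d : ℕ} (ha : 0 < a) :
    IsMulClosed (hermiteLattice a b d) ↔ d ∣ a ^ 2 := by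
  constructor
  · intro h
    have hab : ((a, b) : ℤ × ℤ) ∈ hermiteLattice a b d :=
      mem_hermiteLattice.2 ⟨1, by simp, by simp⟩
    have hdvd : (d : ℤ) ∣ a * a := (zero_prod_mem_hermiteLattice ha).1 (h _ hab _ hab)
    rw [← sq] at hdvd
    exact_mod_cast hdvd
  · intro h x hx y hy
    obtain ⟨k, hk, -⟩ := mem_hermiteLattice.1 hx
    obtain ⟨l, hl, -⟩ := mem_hermiteLattice.1 hy
    have h' : (d : ℤ) ∣ a ^ 2 := by exact_mod_cast h
    rw [zero_prod_mem_hermiteLattice ha, hk, hl, mul_mul_mul_comm, ← sq]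
    exact h'.mul_right _

/-- The parameters `((a, d), b)` in Hermite normal form of the multiplicatively closed sublattices
of `ℤ t + ℤ t ^ 2` of index `n`. -/
def hermiteParams (n : ℕ) : Finset ((_ : ℕ × ℕ) × ℕ) :=
  (n.divisorsAntidiagonal.filter fun x => x.2 ∣ x.1 ^ 2).sigma fun x => Finset.range x.2

lemma mem_hermiteParams {n : ℕ} {x : (_ : ℕ × ℕ) × ℕ} :
    x ∈ hermiteParams n ↔ (x.1.1 * x.1.2 = n ∧ n ≠ 0) ∧ x.1.2 ∣ x.1.1 ^ 2 ∧ x.2 < x.1.2 := by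
  simp [hermiteParams, and_assoc]

lemma pos_of_mem_hermiteParams {n : ℕ} {x : (_ : ℕ × ℕ) × ℕ} (hx : x ∈ hermiteParams n) :
    0 < x.1.1 := by
  obtain ⟨⟨h, hn⟩, -⟩ := mem_hermiteParams.1 hx
  exact Nat.pos_of_ne_zero (left_ne_zero_of_mul (h ▸ hn))

lemma bijOn_hermiteLattice {n : ℕ} (hn : n ≠ 0) :
    Set.BijOn (fun x : (_ : ℕ × ℕ) × ℕ => hermiteLattice x.1.1 x.2 x.1.2) (hermiteParams n)
      {H | H.index = n ∧ IsMulClosed H} := by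
  refine ⟨fun x hx => ?_, fun x hx y hy hxy => ?_, fun H ⟨hindex, hH⟩ => ?_⟩
  · have ha := pos_of_mem_hermiteParams hx
    obtain ⟨⟨hx, -⟩, hdvd, -⟩ := mem_hermiteParams.1 hx
    exact ⟨(index_hermiteLattice ha).trans hx, (isMulClosed_hermiteLattice_iff ha).2 hdvd⟩
  · obtain ⟨ha, hb, hd⟩ := hermiteLattice_inj (pos_of_mem_hermiteParams hx)
      (pos_of_mem_hermiteParams hy) (mem_hermiteParams.1 hx).2.2 (mem_hermiteParams.1 hy).2.2 hxy
    exact Sigma.ext (Prod.ext ha hd) (heq_of_eq hb)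
  · obtain ⟨a, b, d, ha, hb, rfl⟩ := exists_eq_hermiteLattice (hindex.trans_ne hn)
    refine ⟨⟨(a, d), b⟩, mem_hermiteParams.2 ⟨⟨?_, hn⟩, ?_, hb⟩, rfl⟩
    · rw [← hindex, index_hermiteLattice ha]
    · exact (isMulClosed_hermiteLattice_iff ha).1 hH

lemma finite_subringsOfIndex {n : ℕ} (hn : n ≠ 0) : (subringsOfIndex n).Finite :=
  (bijOn_map_tail n).finite_iff_finite.2 <|
    (bijOn_hermiteLattice hn).finite_iff_finite.1 (hermiteParams n).finite_toSet

/-! ### Cocyclic subrings -/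

lemma bijective_eval_of_subsingleton {ι : Type*} {M : ι → Type*} [∀ i, Zero (M i)] {i : ι}
    (h : ∀ j ≠ i, Subsingleton (M j)) :
    Function.Bijective (Function.eval i : (∀ j, M j) → M i) := by
  classical
  refine ⟨fun x y hxy => funext fun j => ?_, fun z => ⟨Pi.single i z, Pi.single_eq_same i z⟩⟩
  obtain rfl | hj := eq_or_ne j i
  · exact hxy
  · exact (h j hj).elim _ _

lemma corank_le_one_iff {m : ℕ} {α : Fin (m + 1) → ℕ} : corank α ≤ 1 ↔ ∀ i ≠ 0, α i = 1 := by
  simp only [corank, Finset.sup_le_iff, Finset.mem_filter, Finset.mem_univ, true_and,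
    add_le_iff_nonpos_left, Nat.le_zero, Fin.val_eq_zero_iff]
  exact forall_congr' fun i => not_imp_comm

lemma exists_isCotype_corank_le_one_iff {A : Type*} [AddCommGroup A] {m : ℕ} {Λ : AddSubgroup A} :
    (∃ α : Fin (m + 1) → ℕ, IsCotype Λ α ∧ corank α ≤ 1) ↔
      Λ.index ≠ 0 ∧ IsAddCyclic (A ⧸ Λ) := by
  have eval_bijective {α : Fin (m + 1) → ℕ} (hα : ∀ i ≠ 0, α i = 1) :
      Function.Bijective (Pi.evalAddMonoidHom (fun i => ZMod (α i)) 0) :=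
    bijective_eval_of_subsingleton fun i hi => by rw [hα i hi]; infer_instance
  constructor
  · rintro ⟨α, ⟨hpos, -, ⟨e⟩⟩, hcorank⟩
    have e' : A ⧸ Λ ≃+ ZMod (α 0) :=
      e.trans (AddEquiv.ofBijective _ (eval_bijective (corank_le_one_iff.1 hcorank)))
    refine ⟨?_, e'.isAddCyclic.2 inferInstance⟩
    rw [index_eq_card, Nat.card_congr e'.toEquiv, Nat.card_zmod]
    exact (hpos 0).ne'
  · rintro ⟨hindex, hcyc⟩
    let α : Fin (m + 1) → ℕ := Function.update 1 0 Λ.index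
    have hα : ∀ i ≠ 0, α i = 1 := fun i hi => Function.update_of_ne hi _ _
    have hα0 : α 0 = Λ.index := Function.update_self _ _ _
    have e : ZMod (α 0) ≃+ A ⧸ Λ := hα0 ▸ zmodAddCyclicAddEquiv hcyc
    refine ⟨α, ⟨fun i => ?_, fun i j hij => ?_, ⟨?_⟩⟩, corank_le_one_iff.2 hα⟩
    · obtain rfl | hi := eq_or_ne i 0
      · rw [hα0]; exact Nat.pos_of_ne_zero hindex
      · rw [hα i hi]; exact one_pos
    · obtain rfl | hj := eq_or_ne j 0
      · rw [Fin.le_zero_iff.1 hij]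
      · rw [hα j hj]; exact one_dvd _
    · exact e.symm.trans (AddEquiv.ofBijective _ (eval_bijective hα)).symm

lemma isAddCyclic_quotient_map_iff {G G' : Type*} [AddCommGroup G] [AddCommGroup G'] {f : G →+ G'}
    (hf : Function.Surjective f) {H : AddSubgroup G} (hker : f.ker ≤ H) :
    IsAddCyclic (G' ⧸ H.map f) ↔ IsAddCyclic (G ⧸ H) := by
  have hH : ((QuotientAddGroup.mk' (H.map f)).comp f).ker = H := by
    rw [← AddMonoidHom.comap_ker, QuotientAddGroup.ker_mk', comap_map_eq_self hker]
  have e : G ⧸ H ≃+ G' ⧸ H.map f :=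
    (QuotientAddGroup.quotientAddEquivOfEq hH.symm).trans
      (QuotientAddGroup.quotientKerEquivOfSurjective _
        ((QuotientAddGroup.mk'_surjective _).comp hf))
  exact e.isAddCyclic.symm

lemma isCocyclic_iff {S : Subring R} (hS : S.toAddSubgroup.index ≠ 0) :
    IsCocyclic S ↔ IsAddCyclic ((ℤ × ℤ) ⧸ S.toAddSubgroup.map tail) := by
  rw [isAddCyclic_quotient_map_iff tail_surjective (ker_tail_le S), IsCocyclic,
    exists_isCotype_corank_le_one_iff, and_iff_right hS]

lemma bijOn_sep {α β : Type*} {f : α → β} {s : Set α} {t : Set β} (hf : Set.BijOn f s t)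
    {p : α → Prop} {q : β → Prop} (h : ∀ x ∈ s, p x ↔ q (f x)) :
    Set.BijOn f {x ∈ s | p x} {y ∈ t | q y} := by
  refine ⟨fun x hx => ⟨hf.mapsTo hx.1, (h x hx.1).1 hx.2⟩, hf.injOn.mono (Set.sep_subset _ _), ?_⟩
  rintro y ⟨hy, hq⟩
  obtain ⟨x, hx, rfl⟩ := hf.surjOn hy
  exact ⟨x, ⟨hx, (h x hx).2 hq⟩, rfl⟩

/-! ### Counting subrings of given index -/

lemma a_eq_sum {n : ℕ} (hn : n ≠ 0) :
    a n = ∑ x ∈ n.divisorsAntidiagonal with x.2 ∣ x.1 ^ 2, x.2 := by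
  rw [a, (bijOn_map_tail n).ncard_eq, ← (bijOn_hermiteLattice hn).ncard_eq, Set.ncard_coe_finset,
    hermiteParams, Finset.card_sigma]
  simp only [Finset.card_range]

lemma aCyclic_eq_sum {n : ℕ} (hn : n ≠ 0) :
    aCyclic n = ∑ x ∈ n.divisorsAntidiagonal with x.2 ∣ x.1 ^ 2, x.2.totient := by
  have htail := bijOn_sep (bijOn_map_tail n) (p := IsCocyclic)
    (q := fun H => IsAddCyclic ((ℤ × ℤ) ⧸ H)) fun S hS => isCocyclic_iff (hS.trans_ne hn)
  have hhermite := bijOn_sep (bijOn_hermiteLattice hn) (p := fun x => x.1.2.Coprime x.2)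
    (q := fun H => IsAddCyclic ((ℤ × ℤ) ⧸ H)) fun x hx =>
      (isAddCyclic_quotient_hermiteLattice_iff fun p hp hpd =>
        hp.dvd_of_dvd_pow (hpd.trans (mem_hermiteParams.1 hx).2.1)).symm
  have hsep : {x | x ∈ (hermiteParams n : Set _) ∧ x.1.2.Coprime x.2} =
      ((n.divisorsAntidiagonal.filter fun x => x.2 ∣ x.1 ^ 2).sigma fun x =>
        (Finset.range x.2).filter x.2.Coprime : Set ((_ : ℕ × ℕ) × ℕ)) := by
    ext x
    simp [hermiteParams, and_assoc]
  rw [aCyclic, htail.ncard_eq, ← hhermite.ncard_eq, hsep, Set.ncard_coe_finset, Finset.card_sigma]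
  rfl

open Filter Topology

/-! ### Comparison of sums and integrals -/

section SumIntegral

variable {f : ℝ → ℝ} {y : ℝ}

lemma integral_le_sum_Icc_floor (hy : 1 ≤ y) (hf : AntitoneOn f (Set.Icc 1 y))
    (hnonneg : ∀ u ∈ Set.Icc 1 y, 0 ≤ f u) :
    ∫ u in 1..y, f u ≤ ∑ n ∈ Finset.Icc 1 ⌊y⌋₊, f n := by
  have hN : 1 ≤ ⌊y⌋₊ := Nat.le_floor (by simpa using hy)
  have hN' : (1 : ℝ) ≤ ⌊y⌋₊ := by exact_mod_cast hN
  have hNy : (⌊y⌋₊ : ℝ) ≤ y := Nat.floor_le (by linarith)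
  have hleft : AntitoneOn f (Set.Icc 1 ⌊y⌋₊) := hf.mono (Set.Icc_subset_Icc_right hNy)
  have hright : AntitoneOn f (Set.Icc ⌊y⌋₊ y) := hf.mono (Set.Icc_subset_Icc_left hN')
  have hint : IntervalIntegrable f MeasureTheory.volume ⌊y⌋₊ y :=
    AntitoneOn.intervalIntegrable (by rwa [Set.uIcc_of_le hNy])
  have htail : ∫ u in (⌊y⌋₊ : ℝ)..y, f u ≤ f ⌊y⌋₊ := by
    calc ∫ u in (⌊y⌋₊ : ℝ)..y, f u ≤ ∫ _ in (⌊y⌋₊ : ℝ)..y, f ⌊y⌋₊ :=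
          intervalIntegral.integral_mono_on hNy hint intervalIntegrable_const
            fun u hu => hright (Set.left_mem_Icc.2 hNy) hu hu.1
      _ = (y - ⌊y⌋₊) * f ⌊y⌋₊ := by simp
      _ ≤ f ⌊y⌋₊ := mul_le_of_le_one_left (hnonneg _ ⟨hN', hNy⟩)
          (by linarith [Nat.lt_floor_add_one y])
  have hhead : ∫ u in (1 : ℝ)..⌊y⌋₊, f u ≤ ∑ n ∈ Finset.Ico 1 ⌊y⌋₊, f n := by
    simpa using AntitoneOn.integral_le_sum_Ico hN (by simpa using hleft)
  rw [← intervalIntegral.integral_add_adjacent_intervals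
    (AntitoneOn.intervalIntegrable (by rwa [Set.uIcc_of_le hN'])) hint,
    ← Finset.sum_Ico_add_eq_sum_Icc hN]
  exact add_le_add hhead htail

lemma sum_Icc_floor_le_integral (hy : 1 ≤ y) (hf : AntitoneOn f (Set.Icc 1 y))
    (hnonneg : ∀ u ∈ Set.Icc 1 y, 0 ≤ f u) :
    ∑ n ∈ Finset.Icc 1 ⌊y⌋₊, f n ≤ f 1 + ∫ u in 1..y, f u := by
  have hN : 1 ≤ ⌊y⌋₊ := Nat.le_floor (by simpa using hy)
  have hN' : (1 : ℝ) ≤ ⌊y⌋₊ := by exact_mod_cast hN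
  have hNy : (⌊y⌋₊ : ℝ) ≤ y := Nat.floor_le (by linarith)
  have hleft : AntitoneOn f (Set.Icc 1 ⌊y⌋₊) := hf.mono (Set.Icc_subset_Icc_right hNy)
  have hhead : ∑ n ∈ Finset.Ioc 1 ⌊y⌋₊, f n ≤ ∫ u in (1 : ℝ)..⌊y⌋₊, f u := by
    rw [← Finset.Ico_add_one_add_one_eq_Ioc, ← Finset.sum_Ico_add']
    simpa using AntitoneOn.sum_le_integral_Ico hN (by simpa using hleft)
  have htail : ∫ u in (1 : ℝ)..⌊y⌋₊, f u ≤ ∫ u in 1..y, f u := by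
    refine intervalIntegral.integral_mono_interval le_rfl hN' hNy ?_
      (AntitoneOn.intervalIntegrable (by rwa [Set.uIcc_of_le hy]))
    exact (MeasureTheory.ae_restrict_iff' measurableSet_Ioc).2
      (.of_forall fun u hu => hnonneg u (Set.Ioc_subset_Icc_self hu))
  rw [← Finset.add_sum_Ioc_eq_sum_Icc hN, Nat.cast_one]
  linarith

end SumIntegral

lemma antitoneOn_log_div_div {y : ℝ} :
    AntitoneOn (fun u => Real.log (y / u) / u) (Set.Icc 1 y) := by
  intro u ⟨hu, huy⟩ v ⟨hv, hvy⟩ huv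
  have hu0 : 0 < u := by linarith
  have hyv : 0 < y / v := div_pos (by linarith) (by linarith)
  exact div_le_div₀ (Real.log_nonneg ((one_le_div hu0).2 huy))
    (Real.log_le_log hyv (div_le_div_of_nonneg_left (by linarith) hu0 huv)) hu0 huv

lemma integral_log_div_div {y : ℝ} (hy : 1 ≤ y) :
    ∫ u in 1..y, Real.log (y / u) / u = Real.log y ^ 2 / 2 := by
  have hderiv : ∀ u ∈ Set.uIcc 1 y,
      HasDerivAt (fun u => -Real.log (y / u) ^ 2 / 2) (Real.log (y / u) / u) u := by
    intro u hu
    rw [Set.uIcc_of_le hy] at hu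
    have hu0 : u ≠ 0 := by linarith [hu.1]
    have hyu : y / u ≠ 0 := div_ne_zero (by linarith) hu0
    refine ((((hasDerivAt_const u y).div (hasDerivAt_id u) hu0).log hyu).pow 2).neg.div_const 2
      |>.congr_deriv ?_
    simp only [Pi.div_apply, id]
    field_simp
    ring
  rw [intervalIntegral.integral_eq_sub_of_hasDerivAt hderiv
    (AntitoneOn.intervalIntegrable (by rw [Set.uIcc_of_le hy]; exact antitoneOn_log_div_div))]
  rw [div_self (show y ≠ 0 by linarith), Real.log_one, div_one]
  ring

lemma abs_sum_log_div_div_sub_le {y : ℝ} (hy : 1 ≤ y) :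
    |∑ s ∈ Finset.Icc 1 ⌊y⌋₊, Real.log (y / s) / s - Real.log y ^ 2 / 2| ≤ Real.log y := by
  have hnonneg : ∀ u ∈ Set.Icc 1 y, 0 ≤ Real.log (y / u) / u := fun u ⟨hu, huy⟩ =>
    div_nonneg (Real.log_nonneg ((one_le_div (by linarith)).2 huy)) (by linarith)
  have hlower := integral_le_sum_Icc_floor hy antitoneOn_log_div_div hnonneg
  have hupper := sum_Icc_floor_le_integral hy antitoneOn_log_div_div hnonneg
  rw [integral_log_div_div hy] at hlower hupper
  rw [div_one, div_one] at hupper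
  rw [abs_le]
  constructor <;> linarith [Real.log_nonneg hy]

/-! ### Weighted sums over pairs -/

/-- The number of `m ≥ 1` with `m r^2 s^3 ≤ B`, weighted by `r s^2`, at `x = (r, s)`; it vanishes
if `r = 0` or `s = 0`. -/
noncomputable def weight (B : ℝ) (x : ℕ × ℕ) : ℝ :=
  x.1 * x.2 ^ 2 * ⌊B / (x.1 ^ 2 * x.2 ^ 3)⌋₊

/-- The sum of `F (r, s)` over all `(r, s)`, weighted by `weight B`. It has finitely many nonzero
terms. -/
noncomputable def weightedSum (F : ℕ × ℕ → ℝ) (B : ℝ) : ℝ := ∑' x, F x * weight B x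

lemma weight_nonneg (B : ℝ) (x : ℕ × ℕ) : 0 ≤ weight B x := by unfold weight; positivity

lemma weight_ne_zero_iff {B : ℝ} {x : ℕ × ℕ} :
    weight B x ≠ 0 ↔ 0 < x.1 ∧ 0 < x.2 ∧ (x.1 ^ 2 * x.2 ^ 3 : ℝ) ≤ B := by
  rcases Nat.eq_zero_or_pos x.1 with h₁ | h₁
  · simp [weight, h₁]
  rcases Nat.eq_zero_or_pos x.2 with h₂ | h₂
  · simp [weight, h₂]
  rw [weight, mul_ne_zero_iff_left (by positivity), Nat.cast_ne_zero, ← Nat.pos_iff_ne_zero,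
    Nat.floor_pos, one_le_div (by positivity)]
  simp only [h₁, h₂, true_and]

lemma le_floor_of_weight_ne_zero {B : ℝ} {x : ℕ × ℕ} (hx : weight B x ≠ 0) :
    x.1 ≤ ⌊B⌋₊ ∧ x.2 ^ 3 ≤ ⌊B⌋₊ := by
  obtain ⟨h₁, h₂, hB⟩ := weight_ne_zero_iff.1 hx
  have hle : x.1 ^ 2 * x.2 ^ 3 ≤ ⌊B⌋₊ := Nat.le_floor (by exact_mod_cast hB)
  constructor
  · calc x.1 ≤ x.1 ^ 2 := Nat.le_self_pow two_ne_zero _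
      _ ≤ x.1 ^ 2 * x.2 ^ 3 := Nat.le_mul_of_pos_right _ (by positivity)
      _ ≤ ⌊B⌋₊ := hle
  · exact (Nat.le_mul_of_pos_left _ (by positivity)).trans hle

lemma mem_box_of_weight_ne_zero {B : ℝ} {x : ℕ × ℕ} (hx : weight B x ≠ 0) :
    x ∈ Finset.Icc 1 ⌊B⌋₊ ×ˢ Finset.Icc 1 ⌊B⌋₊ := by
  obtain ⟨h₁, h₂, -⟩ := weight_ne_zero_iff.1 hx
  obtain ⟨hle₁, hle₂⟩ := le_floor_of_weight_ne_zero hx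
  exact Finset.mem_product.2 ⟨Finset.mem_Icc.2 ⟨h₁, hle₁⟩,
    Finset.mem_Icc.2 ⟨h₂, (Nat.le_self_pow three_ne_zero _).trans hle₂⟩⟩

lemma weightedSum_eq_sum (F : ℕ × ℕ → ℝ) {B : ℝ} {t : Finset (ℕ × ℕ)}
    (ht : ∀ x, weight B x ≠ 0 → x ∈ t) : weightedSum F B = ∑ x ∈ t, F x * weight B x :=
  tsum_eq_sum' fun x hx => ht x (right_ne_zero_of_mul hx)

lemma summable_mul_weight (F : ℕ × ℕ → ℝ) (B : ℝ) : Summable fun x => F x * weight B x :=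
  summable_of_hasFiniteSupport ((Finset.finite_toSet _).subset fun _ hx =>
    mem_box_of_weight_ne_zero (right_ne_zero_of_mul hx))

lemma weightedSum_of_lt_one (F : ℕ × ℕ → ℝ) {B : ℝ} (hB : B < 1) : weightedSum F B = 0 := by
  rw [weightedSum_eq_sum F fun _ => mem_box_of_weight_ne_zero, Nat.floor_eq_zero.2 hB]
  rfl

lemma weightedSum_add (F G : ℕ × ℕ → ℝ) (B : ℝ) :
    weightedSum (F + G) B = weightedSum F B + weightedSum G B := by
  simp only [weightedSum, Pi.add_apply, add_mul]
  exact (summable_mul_weight F B).tsum_add (summable_mul_weight G B)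

lemma weightedSum_smul (c : ℝ) (F : ℕ × ℕ → ℝ) (B : ℝ) :
    weightedSum (c • F) B = c * weightedSum F B := by
  simp only [weightedSum, Pi.smul_apply, smul_eq_mul, mul_assoc, tsum_mul_left]

lemma weightedSum_sum {ι : Type*} (u : Finset ι) (F : ι → ℕ × ℕ → ℝ) (B : ℝ) :
    weightedSum (∑ i ∈ u, F i) B = ∑ i ∈ u, weightedSum (F i) B := by
  simp only [weightedSum, Finset.sum_apply, Finset.sum_mul]
  exact Summable.tsum_finsetSum fun i _ => summable_mul_weight (F i) B

lemma weightedSum_mono {F G : ℕ × ℕ → ℝ} {B : ℝ} (h : ∀ x, weight B x ≠ 0 → F x ≤ G x) :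
    weightedSum F B ≤ weightedSum G B := by
  refine (summable_mul_weight F B).tsum_le_tsum (fun x => ?_) (summable_mul_weight G B)
  rcases eq_or_ne (weight B x) 0 with hx | hx
  · rw [hx, mul_zero, mul_zero]
  · exact mul_le_mul_of_nonneg_right (h x hx) (weight_nonneg B x)

/-! ### The sum of the weights -/

lemma log_le_sum_inv_Icc_floor {y : ℝ} (hy : 0 ≤ y) :
    Real.log y ≤ ∑ n ∈ Finset.Icc 1 ⌊y⌋₊, (n : ℝ)⁻¹ := by
  simpa [harmonic_eq_sum_Icc] using log_le_harmonic_floor y hy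

lemma sum_inv_Icc_floor_le {y : ℝ} (hy : 1 ≤ y) :
    ∑ n ∈ Finset.Icc 1 ⌊y⌋₊, (n : ℝ)⁻¹ ≤ 1 + Real.log y := by
  simpa [harmonic_eq_sum_Icc] using harmonic_floor_le_one_add_log y hy

lemma abs_sum_mul_floor_div_sq_sub_le {z : ℝ} (hz : 1 ≤ z) :
    |∑ r ∈ Finset.Icc 1 ⌊√z⌋₊, (r : ℝ) * ⌊z / r ^ 2⌋₊ - z * Real.log z / 2| ≤ z := by
  have hz0 : 0 ≤ z := by linarith
  have hsqrt : 1 ≤ √z := Real.one_le_sqrt.2 hz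
  have hlower := log_le_sum_inv_Icc_floor (Real.sqrt_nonneg z)
  have hupper := sum_inv_Icc_floor_le hsqrt
  rw [Real.log_sqrt hz0] at hlower hupper
  have hterm : ∀ r ∈ Finset.Icc 1 ⌊√z⌋₊, (r : ℝ) * ⌊z / r ^ 2⌋₊ ≤ z * (r : ℝ)⁻¹ ∧
      z * (r : ℝ)⁻¹ - √z ≤ r * ⌊z / r ^ 2⌋₊ := by
    intro r hr
    obtain ⟨hr1, hr2⟩ := Finset.mem_Icc.1 hr
    have hr0 : (0 : ℝ) < r := by exact_mod_cast hr1
    have hr_le : (r : ℝ) ≤ √z := (Nat.le_floor_iff (Real.sqrt_nonneg z)).1 hr2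
    have hquot : r * (z / (r : ℝ) ^ 2) = z * (r : ℝ)⁻¹ := by field_simp
    rw [← hquot]
    constructor
    · gcongr
      exact Nat.floor_le (by positivity)
    · nlinarith [Nat.lt_floor_add_one (z / (r : ℝ) ^ 2)]
  have hcard : ∑ _r ∈ Finset.Icc 1 ⌊√z⌋₊, √z ≤ z := by
    rw [Finset.sum_const, Nat.card_Icc, Nat.add_sub_cancel, nsmul_eq_mul]
    calc ⌊√z⌋₊ * √z ≤ √z * √z := by gcongr; exact Nat.floor_le (Real.sqrt_nonneg z)
      _ = z := Real.mul_self_sqrt hz0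
  have hsum_le := Finset.sum_le_sum fun r hr => (hterm r hr).1
  have hle_sum := Finset.sum_le_sum fun r hr => (hterm r hr).2
  rw [Finset.sum_sub_distrib] at hle_sum
  rw [← Finset.mul_sum] at hsum_le hle_sum
  rw [abs_le]
  constructor <;> nlinarith

lemma abs_sum_weight_sub_le {B : ℝ} {s : ℕ} (hs : 0 < s) (hsB : (s : ℝ) ^ 3 ≤ B) :
    |∑ r ∈ Finset.Icc 1 ⌊B⌋₊, weight B (r, s) - B / s * (Real.log (B / s ^ 3) / 2)| ≤ B / s := by
  have hs1 : (1 : ℝ) ≤ s := by exact_mod_cast hs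
  set z := B / (s : ℝ) ^ 3 with hz
  have hz1 : 1 ≤ z := (one_le_div (by positivity)).2 hsB
  have hB0 : 0 < B := lt_of_lt_of_le (by positivity) hsB
  have hweight : ∀ r : ℕ, weight B (r, s) = (s : ℝ) ^ 2 * (r * ⌊z / r ^ 2⌋₊) := fun r => by
    rw [weight, hz, div_div, mul_comm ((s : ℝ) ^ 3)]
    ring
  have hsqrt : √z ≤ B := calc
    √z ≤ z := Real.sqrt_le_self_iff.2 (.inr hz1)
    _ ≤ B := div_le_self hB0.le (one_le_pow₀ hs1)
  have htrunc : ∑ r ∈ Finset.Icc 1 ⌊B⌋₊, weight B (r, s)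
      = ∑ r ∈ Finset.Icc 1 ⌊√z⌋₊, weight B (r, s) := by
    refine (Finset.sum_subset (Finset.Icc_subset_Icc_right (Nat.floor_le_floor hsqrt))
      fun r _ hr => not_imp_comm.1 (fun hne => ?_) hr).symm
    obtain ⟨hr0, -, hrB⟩ := weight_ne_zero_iff.1 hne
    refine Finset.mem_Icc.2 ⟨hr0, Nat.le_floor (Real.le_sqrt_of_sq_le ?_)⟩
    exact (le_div_iff₀ (by positivity)).2 hrB
  have hscale : B / s = (s : ℝ) ^ 2 * z := by rw [hz]; field_simp
  rw [htrunc, Finset.sum_congr rfl fun r _ => hweight r, ← Finset.mul_sum, hscale, mul_assoc,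
    ← mul_sub, abs_mul, abs_of_nonneg (by positivity), ← mul_div_assoc]
  gcongr
  exact abs_sum_mul_floor_div_sq_sub_le hz1

lemma weightedSum_one_eq_sum_sum {B y : ℝ} (hy : 0 ≤ y) (hyB : y ^ 3 = B) :
    weightedSum 1 B = ∑ s ∈ Finset.Icc 1 ⌊y⌋₊, ∑ r ∈ Finset.Icc 1 ⌊B⌋₊, weight B (r, s) := by
  have hmem : ∀ x, weight B x ≠ 0 → x ∈ Finset.Icc 1 ⌊B⌋₊ ×ˢ Finset.Icc 1 ⌊y⌋₊ := by
    intro x hx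
    obtain ⟨h₁, h₂, -⟩ := weight_ne_zero_iff.1 hx
    obtain ⟨hle₁, hle₂⟩ := le_floor_of_weight_ne_zero hx
    have hcube : (x.2 : ℝ) ^ 3 ≤ y ^ 3 := by
      rw [hyB]
      exact_mod_cast Nat.floor_le (hyB ▸ by positivity : 0 ≤ B) |>.trans' (Nat.cast_le.2 hle₂)
    exact Finset.mem_product.2 ⟨Finset.mem_Icc.2 ⟨h₁, hle₁⟩,
      Finset.mem_Icc.2 ⟨h₂, Nat.le_floor (le_of_pow_le_pow_left₀ three_ne_zero hy hcube)⟩⟩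
  rw [weightedSum_eq_sum 1 hmem, Finset.sum_product_right]
  simp only [Pi.one_apply, one_mul]

lemma abs_weightedSum_one_sub_le {B : ℝ} (hB : 1 ≤ B) :
    |weightedSum 1 B - B * Real.log B ^ 2 / 12| ≤ B * (1 + Real.log B) := by
  have hB0 : 0 < B := by linarith
  set y := B ^ (1 / 3 : ℝ) with hy
  have hy1 : 1 ≤ y := Real.one_le_rpow hB (by norm_num)
  have hyB : y ^ 3 = B := by
    rw [hy, ← Real.rpow_natCast, ← Real.rpow_mul hB0.le]
    norm_num
  have hlog : Real.log B = 3 * Real.log y := by rw [← hyB, Real.log_pow]; norm_num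
  have hrow : ∀ s ∈ Finset.Icc 1 ⌊y⌋₊, |∑ r ∈ Finset.Icc 1 ⌊B⌋₊, weight B (r, s)
      - 3 / 2 * B * (Real.log (y / s) / s)| ≤ B * (s : ℝ)⁻¹ := by
    intro s hs
    obtain ⟨hs0, hsy⟩ := Finset.mem_Icc.1 hs
    have hsB : (s : ℝ) ^ 3 ≤ B := by
      rw [← hyB]
      gcongr
      exact (Nat.le_floor_iff (by linarith)).1 hsy
    rw [← div_eq_mul_inv]
    convert abs_sum_weight_sub_le hs0 hsB using 3
    rw [← hyB, ← div_pow, Real.log_pow]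
    push_cast
    ring
  have hrows : |weightedSum 1 B - 3 / 2 * B * ∑ s ∈ Finset.Icc 1 ⌊y⌋₊, Real.log (y / s) / s|
      ≤ B * (1 + Real.log y) := by
    rw [weightedSum_one_eq_sum_sum (by linarith) hyB, Finset.mul_sum, ← Finset.sum_sub_distrib]
    refine (Finset.abs_sum_le_sum_abs _ _).trans ((Finset.sum_le_sum hrow).trans ?_)
    rw [← Finset.mul_sum]
    gcongr
    exact sum_inv_Icc_floor_le hy1
  have hint := abs_sum_log_div_div_sub_le hy1
  rw [hlog]
  rw [abs_le] at hrows hint ⊢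
  constructor <;> nlinarith [mul_nonneg hB0.le (Real.log_nonneg hy1)]

lemma weightedSum_one_div_le {B k : ℝ} (hB : 1 ≤ B) (hk : 1 ≤ k) :
    weightedSum 1 (B / k) ≤ B / k * (1 + Real.log B) ^ 2 := by
  have hBk : 0 < B / k := by positivity
  rcases lt_or_ge (B / k) 1 with h | h
  · rw [weightedSum_of_lt_one _ h]
    positivity
  · have hlog_nonneg := Real.log_nonneg h
    have hlog_le : Real.log (B / k) ≤ Real.log B :=
      Real.log_le_log hBk (div_le_self (by linarith) hk)
    calc weightedSum 1 (B / k)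
        ≤ B / k * Real.log (B / k) ^ 2 / 12 + B / k * (1 + Real.log (B / k)) := by
          linarith [(abs_le.1 (abs_weightedSum_one_sub_le h)).2]
      _ ≤ B / k * (1 + Real.log (B / k)) ^ 2 := by
          nlinarith [mul_nonneg hBk.le hlog_nonneg,
            mul_nonneg hBk.le (sq_nonneg (Real.log (B / k)))]
      _ ≤ B / k * (1 + Real.log B) ^ 2 := by gcongr

/-! ### Densities -/

/-- The sum of `F` weighted by `weight B` is asymptotic to `c * B * (log B) ^ 2`, or negligible
against `B * (log B) ^ 2` if `c = 0`. -/
def HasDensity (F : ℕ × ℕ → ℝ) (c : ℝ) : Prop :=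
  Tendsto (fun B : ℝ => weightedSum F B / (B * Real.log B ^ 2)) atTop (𝓝 c)

lemma HasDensity.add {F G : ℕ × ℕ → ℝ} {c d : ℝ} (hF : HasDensity F c) (hG : HasDensity G d) :
    HasDensity (F + G) (c + d) :=
  (Tendsto.add hF hG).congr fun B => by rw [weightedSum_add, add_div]

lemma HasDensity.smul {F : ℕ × ℕ → ℝ} {c : ℝ} (a : ℝ) (hF : HasDensity F c) :
    HasDensity (a • F) (a * c) :=
  (Tendsto.const_mul a hF).congr fun B => by rw [weightedSum_smul, mul_div_assoc]

lemma hasDensity_one : HasDensity 1 (1 / 12) := by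
  have herror : Tendsto (fun B : ℝ => (Real.log B)⁻¹ ^ 2 + (Real.log B)⁻¹) atTop (𝓝 0) := by
    have h := tendsto_inv_atTop_zero.comp Real.tendsto_log_atTop
    simpa using (h.pow 2).add h
  refine tendsto_iff_dist_tendsto_zero.2
    (squeeze_zero' (.of_forall fun _ => dist_nonneg) ?_ herror)
  filter_upwards [eventually_gt_atTop 1] with B hB
  have hlog : 0 < Real.log B := Real.log_pos hB
  have hmain : 0 < B * Real.log B ^ 2 := by positivity
  have hquot : weightedSum 1 B / (B * Real.log B ^ 2) - 1 / 12
      = (weightedSum 1 B - B * Real.log B ^ 2 / 12) / (B * Real.log B ^ 2) := by field_simp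
  rw [Real.dist_eq, hquot, abs_div, abs_of_pos hmain, div_le_iff₀ hmain]
  calc |weightedSum 1 B - B * Real.log B ^ 2 / 12| ≤ B * (1 + Real.log B) :=
        abs_weightedSum_one_sub_le hB.le
    _ = ((Real.log B)⁻¹ ^ 2 + (Real.log B)⁻¹) * (B * Real.log B ^ 2) := by field_simp

lemma tendsto_comp_div_div_mul_log_sq {u : ℝ → ℝ} {c k : ℝ} (hk : 0 < k)
    (hu : Tendsto (fun B : ℝ => u B / (B * Real.log B ^ 2)) atTop (𝓝 c)) :
    Tendsto (fun B : ℝ => u (B / k) / (B * Real.log B ^ 2)) atTop (𝓝 (c / k)) := by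
  have hcomp := hu.comp (tendsto_id.atTop_div_const hk)
  have hlog : Tendsto (fun B : ℝ => (1 - Real.log k / Real.log B) ^ 2) atTop (𝓝 1) := by
    have h := (tendsto_const_nhds (x := Real.log k)).div_atTop Real.tendsto_log_atTop
    simpa using (tendsto_const_nhds (x := (1 : ℝ)).sub h).pow 2
  have hprod := (hcomp.mul hlog).div_const k
  rw [mul_one] at hprod
  refine hprod.congr' ?_
  filter_upwards [eventually_gt_atTop 1, eventually_gt_atTop k] with B hB hBk
  have hlogB : 0 < Real.log B := Real.log_pos hB
  have hlog_sub : 0 < Real.log B - Real.log k := sub_pos.2 (Real.log_lt_log hk hBk)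
  simp only [Function.comp, id]
  rw [Real.log_div (by positivity) hk.ne']
  field_simp

/-- The set of pairs `(r, s)` with `k ∣ r` and `l ∣ s`. -/
def dvdSet (k l : ℕ) : Set (ℕ × ℕ) := {x | k ∣ x.1 ∧ l ∣ x.2}

lemma weightedSum_indicator_dvdSet (F : ℕ × ℕ → ℝ) (B : ℝ) {k l : ℕ} (hk : 0 < k) (hl : 0 < l) :
    weightedSum ((dvdSet k l).indicator F) B
      = k * l ^ 2 * weightedSum (fun x => F (k * x.1, l * x.2)) (B / (k ^ 2 * l ^ 3)) := by
  have hinj : Function.Injective (Prod.map (k * ·) (l * ·)) :=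
    (mul_right_injective₀ hk.ne').prodMap (mul_right_injective₀ hl.ne')
  have hsupp : Function.support (fun x => (dvdSet k l).indicator F x * weight B x)
      ⊆ Set.range (Prod.map (k * ·) (l * ·)) := by
    intro x hx
    obtain ⟨⟨r, hr⟩, s, hs⟩ := Set.mem_of_indicator_ne_zero (left_ne_zero_of_mul hx)
    exact ⟨(r, s), Prod.ext hr.symm hs.symm⟩
  rw [weightedSum, weightedSum, ← tsum_mul_left, ← hinj.tsum_eq hsupp]
  refine tsum_congr fun x => ?_
  have hmem : (k * x.1, l * x.2) ∈ dvdSet k l := ⟨dvd_mul_right k x.1, dvd_mul_right l x.2⟩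
  have harg : B / ((k * x.1) ^ 2 * (l * x.2) ^ 3) = B / (k ^ 2 * l ^ 3) / (x.1 ^ 2 * x.2 ^ 3) := by
    rw [div_div]
    ring_nf
  simp only [Prod.map_apply', Set.indicator_of_mem hmem, weight, Nat.cast_mul, harg]
  ring

lemma HasDensity.indicator_dvdSet {F : ℕ × ℕ → ℝ} {c : ℝ} {k l : ℕ} (hk : 0 < k) (hl : 0 < l)
    (hF : HasDensity F c) (hinv : ∀ r s, F (k * r, l * s) = F (r, s)) :
    HasDensity ((dvdSet k l).indicator F) (c / (k * l)) := by
  have h := (tendsto_comp_div_div_mul_log_sq (by positivity : (0 : ℝ) < k ^ 2 * l ^ 3) hF).const_mul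
    (k * l ^ 2 : ℝ)
  have hlim : (k * l ^ 2 * (c / (k ^ 2 * l ^ 3)) : ℝ) = c / (k * l) := by field_simp
  rw [hlim] at h
  refine h.congr fun B => ?_
  rw [weightedSum_indicator_dvdSet F B hk hl, mul_div_assoc]
  simp only [hinv]

/-! ### Local factors -/

/-- The factor at `p` of the function `(r, s) ↦ μ(r)^2 ∏_{p ∣ r s} (1 - A p)`. -/
noncomputable def localFactor (A : ℕ → ℝ) (p : ℕ) (x : ℕ × ℕ) : ℝ :=
  if p ^ 2 ∣ x.1 then 0 else if p ∣ x.1 ∨ p ∣ x.2 then 1 - A p else 1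

/-- The mean value of `localFactor A p` when the events `p ∣ r`, `p ∣ s` are independent of
probability `p⁻¹` and `p ^ 2 ∣ r` has probability `p⁻²`, as they are for the weighting by
`weight B`. -/
noncomputable def localMean (A : ℕ → ℝ) (p : ℕ) : ℝ :=
  1 - 2 * A p * (p : ℝ)⁻¹ + A p * (p : ℝ)⁻¹ ^ 2 - (1 - A p) * (p : ℝ)⁻¹ ^ 2

lemma localFactor_mul (A : ℕ → ℝ) {k l q : ℕ} (hk : q.Coprime k) (hl : q.Coprime l) (r s : ℕ) :
    localFactor A q (k * r, l * s) = localFactor A q (r, s) := by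
  simp only [localFactor, (hk.pow_left 2).dvd_mul_left, hk.dvd_mul_left, hl.dvd_mul_left]

/-- Inclusion–exclusion over the divisibilities `p ∣ r`, `p ∣ s`, `p ^ 2 ∣ r`. -/
lemma localFactor_mul_eq (A : ℕ → ℝ) (p : ℕ) (F : ℕ × ℕ → ℝ) :
    localFactor A p * F = F + -A p • (dvdSet p 1).indicator F + -A p • (dvdSet 1 p).indicator F
      + A p • (dvdSet p p).indicator F + -(1 - A p) • (dvdSet (p ^ 2) 1).indicator F := by
  funext x
  have hdvd : p ^ 2 ∣ x.1 → p ∣ x.1 := (dvd_pow_self _ two_ne_zero).trans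
  simp only [localFactor, dvdSet, Set.indicator_apply, Set.mem_ofPred_eq, one_dvd, and_true,
    true_and, Pi.mul_apply, Pi.add_apply, Pi.smul_apply, smul_eq_mul]
  by_cases hr : p ∣ x.1 <;> by_cases hs : p ∣ x.2 <;> by_cases hsq : p ^ 2 ∣ x.1
  all_goals first
    | exact absurd (hdvd hsq) hr
    | simp only [hr, hs, hsq, if_true, if_false, or_true, or_false, and_true, and_false]
      ring

lemma HasDensity.localFactor_mul {F : ℕ × ℕ → ℝ} {c : ℝ} (A : ℕ → ℝ) {p : ℕ} (hp : 0 < p)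
    (hF : HasDensity F c) (hfst : ∀ r s, F (p * r, s) = F (r, s))
    (hsnd : ∀ r s, F (r, p * s) = F (r, s)) :
    HasDensity (localFactor A p * F) (localMean A p * c) := by
  have hdens := ((((hF.add
    ((hF.indicator_dvdSet hp one_pos (by simpa using hfst)).smul (-A p))).add
    ((hF.indicator_dvdSet one_pos hp (by simpa using hsnd)).smul (-A p))).add
    ((hF.indicator_dvdSet hp hp fun r s => by rw [hfst, hsnd]).smul (A p))).add
    ((hF.indicator_dvdSet (pow_pos hp 2) one_pos
      fun r s => by rw [sq, mul_assoc, hfst, hfst, one_mul]).smul (-(1 - A p))))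
  rw [← localFactor_mul_eq] at hdens
  convert hdens using 1
  rw [localMean]
  push_cast
  field_simp
  ring

lemma hasDensity_prod_localFactor (A : ℕ → ℝ) (t : Finset Nat.Primes) :
    HasDensity (∏ p ∈ t, localFactor A p) (1 / 12 * ∏ p ∈ t, localMean A p) := by
  induction t using Finset.induction_on with
  | empty => simpa using hasDensity_one
  | insert p t hp ih =>
    have hcoprime : ∀ q ∈ t, (q : ℕ).Coprime p := fun q hq =>
      (Nat.coprime_primes q.2 p.2).2 fun h => hp (Subtype.ext h ▸ hq)
    rw [Finset.prod_insert hp, Finset.prod_insert hp, mul_left_comm]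
    refine ih.localFactor_mul A p.2.pos (fun r s => ?_) fun r s => ?_ <;>
      simp only [Finset.prod_apply] <;> refine Finset.prod_congr rfl fun q hq => ?_
    · simpa using CocyclicSubrings.localFactor_mul A (hcoprime q hq) (Nat.coprime_one_right q) r s
    · simpa using CocyclicSubrings.localFactor_mul A (Nat.coprime_one_right q) (hcoprime q hq) r s

/-! ### The sieve -/

lemma localFactor_mem_Icc {A : ℕ → ℝ} {p : ℕ} (hA : A p ∈ Set.Icc 0 1) (x : ℕ × ℕ) :
    localFactor A p x ∈ Set.Icc 0 1 := by
  obtain ⟨hA0, hA1⟩ := hA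
  unfold localFactor
  split_ifs <;> constructor <;> linarith

lemma one_sub_localFactor_le {A : ℕ → ℝ} {p : ℕ} (hA : 0 ≤ A p) (x : ℕ × ℕ) :
    1 - localFactor A p x ≤ A p * (dvdSet p 1).indicator 1 x + A p * (dvdSet 1 p).indicator 1 x
      + (dvdSet (p ^ 2) 1).indicator 1 x := by
  simp only [localFactor, dvdSet, Set.indicator_apply, Set.mem_ofPred_eq, one_dvd, and_true,
    true_and, Pi.one_apply]
  by_cases hr : p ∣ x.1 <;> by_cases hs : p ∣ x.2 <;> by_cases hsq : p ^ 2 ∣ x.1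
  all_goals
    simp only [hr, hs, hsq, if_true, if_false, or_true, or_false]
    linarith

lemma weightedSum_indicator_dvdSet_le {B : ℝ} (hB : 1 ≤ B) {k l : ℕ} (hk : 0 < k) (hl : 0 < l) :
    weightedSum ((dvdSet k l).indicator 1) B ≤ B / (k * l) * (1 + Real.log B) ^ 2 := by
  have hk1 : (1 : ℝ) ≤ k := by exact_mod_cast hk
  have hl1 : (1 : ℝ) ≤ l := by exact_mod_cast hl
  have hkl : (1 : ℝ) ≤ k ^ 2 * l ^ 3 := one_le_mul_of_one_le_of_one_le (one_le_pow₀ hk1)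
    (one_le_pow₀ hl1)
  calc weightedSum ((dvdSet k l).indicator 1) B
      = k * l ^ 2 * weightedSum 1 (B / (k ^ 2 * l ^ 3)) := weightedSum_indicator_dvdSet 1 B hk hl
    _ ≤ k * l ^ 2 * (B / (k ^ 2 * l ^ 3) * (1 + Real.log B) ^ 2) := by
        gcongr
        exact weightedSum_one_div_le hB hkl
    _ = B / (k * l) * (1 + Real.log B) ^ 2 := by field_simp

lemma weightedSum_one_sub_localFactor_le {A : ℕ → ℝ} {p : ℕ} (hp : 0 < p)
    (hA : A p ∈ Set.Icc 0 (p : ℝ)⁻¹) {B : ℝ} (hB : 1 ≤ B) :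
    weightedSum (1 - localFactor A p) B ≤ (p : ℝ)⁻¹ ^ 2 * (3 * B * (1 + Real.log B) ^ 2) := by
  have hfst := weightedSum_indicator_dvdSet_le hB hp one_pos
  have hsnd := weightedSum_indicator_dvdSet_le hB one_pos hp
  have hsq := weightedSum_indicator_dvdSet_le hB (pow_pos hp 2) one_pos
  set X := (1 + Real.log B) ^ 2
  calc weightedSum (1 - localFactor A p) B
      ≤ weightedSum (A p • (dvdSet p 1).indicator 1 + A p • (dvdSet 1 p).indicator 1
          + (dvdSet (p ^ 2) 1).indicator 1) B :=
        weightedSum_mono fun x _ => one_sub_localFactor_le hA.1 x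
    _ = A p * weightedSum ((dvdSet p 1).indicator 1) B
          + A p * weightedSum ((dvdSet 1 p).indicator 1) B
          + weightedSum ((dvdSet (p ^ 2) 1).indicator 1) B := by
        simp only [weightedSum_add, weightedSum_smul]
    _ ≤ A p * (B / (p * (1 : ℕ)) * X) + A p * (B / ((1 : ℕ) * p) * X)
          + B / ((p ^ 2 : ℕ) * (1 : ℕ)) * X := by
        gcongr <;> exact hA.1
    _ ≤ (p : ℝ)⁻¹ * (B / (p * (1 : ℕ)) * X) + (p : ℝ)⁻¹ * (B / ((1 : ℕ) * p) * X)
          + B / ((p ^ 2 : ℕ) * (1 : ℕ)) * X := by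
        gcongr <;> exact hA.2
    _ = (p : ℝ)⁻¹ ^ 2 * (3 * B * X) := by
        push_cast
        field_simp
        ring

lemma one_sub_prod_le_sum_one_sub {ι : Type*} (t : Finset ι) {f : ι → ℝ}
    (hf : ∀ i, f i ∈ Set.Icc 0 1) : 1 - ∏ i ∈ t, f i ≤ ∑ i ∈ t, (1 - f i) := by
  induction t using Finset.cons_induction with
  | empty => simp
  | cons i t hi ih =>
    have hprod : ∏ j ∈ t, f j ≤ 1 := Finset.prod_le_one (fun j _ => (hf j).1) fun j _ => (hf j).2
    rw [Finset.prod_cons, Finset.sum_cons]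
    nlinarith [(hf i).1, (hf i).2]

/-- The function `(r, s) ↦ μ(r)^2 ∏_{p ∣ r s} (1 - A p)`, whose weighted sums for `A p = 0` and
`A p = p⁻¹` count all subrings and the cocyclic ones. -/
noncomputable def sieveWeight (A : ℕ → ℝ) (x : ℕ × ℕ) : ℝ :=
  if Squarefree x.1 then ∏ p ∈ (x.1 * x.2).primeFactors, (1 - A p) else 0

lemma sieveWeight_eq_prod (A : ℕ → ℝ) {x : ℕ × ℕ} (hx₁ : 0 < x.1) (hx₂ : 0 < x.2)
    {t : Finset Nat.Primes} (ht : ∀ p : Nat.Primes, (p : ℕ) ∣ x.1 * x.2 → p ∈ t) :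
    sieveWeight A x = ∏ p ∈ t, localFactor A p x := by
  unfold sieveWeight
  split_ifs with hsq
  · have hfactor : ∀ p ∈ t, localFactor A p x = if (p : ℕ) ∣ x.1 * x.2 then 1 - A p else 1 := by
      intro p _
      have hp : ¬(p : ℕ) ^ 2 ∣ x.1 := fun h =>
        Nat.squarefree_iff_prime_squarefree.1 hsq p p.2 (sq (p : ℕ) ▸ h)
      simp only [localFactor, hp, if_false, p.2.dvd_mul]
    rw [Finset.prod_congr rfl hfactor, ← Finset.prod_filter]
    refine (Finset.prod_nbij (fun p : Nat.Primes => (p : ℕ)) (fun p hp => ?_)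
      Nat.Primes.coe_nat_injective.injOn (fun p hp => ?_) fun _ _ => rfl).symm
    · exact Nat.mem_primeFactors.2 ⟨p.2, (Finset.mem_filter.1 hp).2, by positivity⟩
    · obtain ⟨hprime, hdvd, -⟩ := Nat.mem_primeFactors.1 hp
      exact ⟨⟨p, hprime⟩, Finset.mem_filter.2 ⟨ht _ hdvd, hdvd⟩, rfl⟩
  · rw [Nat.squarefree_iff_prime_squarefree] at hsq
    push Not at hsq
    obtain ⟨p, hp, hdvd⟩ := hsq
    rw [← sq] at hdvd
    have hp_dvd : p ∣ x.1 * x.2 := ((dvd_pow_self p two_ne_zero).trans hdvd).mul_right x.2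
    symm
    exact Finset.prod_eq_zero (ht ⟨p, hp⟩ hp_dvd) (if_pos hdvd)

lemma summable_primes_inv_pow {k : ℕ} (hk : 1 < k) :
    Summable fun p : Nat.Primes => ((p : ℕ) : ℝ)⁻¹ ^ k := by
  simp only [inv_pow]
  exact (Real.summable_nat_pow_inv.2 hk).comp_injective Nat.Primes.coe_nat_injective

section Sieve

variable {A : ℕ → ℝ}

lemma exists_sieveWeight_mem_Icc (hA : ∀ p : Nat.Primes, A p ∈ Set.Icc 0 ((p : ℕ) : ℝ)⁻¹)
    (t : Finset Nat.Primes) (B : ℝ) :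
    ∃ u : Finset Nat.Primes, Disjoint t u ∧ ∀ x, weight B x ≠ 0 →
      sieveWeight A x ∈ Set.Icc (∏ p ∈ t, localFactor A p x - ∑ p ∈ u, (1 - localFactor A p x))
        (∏ p ∈ t, localFactor A p x) := by
  classical
  let primesLE : Finset Nat.Primes := Finset.subtype Nat.Prime (Finset.range (⌊B⌋₊ + 1))
  refine ⟨primesLE \ t, Finset.disjoint_sdiff, fun x hx => ?_⟩
  obtain ⟨hx₁, hx₂, -⟩ := weight_ne_zero_iff.1 hx
  have hbox := mem_box_of_weight_ne_zero hx
  simp only [Finset.mem_product, Finset.mem_Icc] at hbox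
  have hmem : ∀ p : Nat.Primes, (p : ℕ) ∣ x.1 * x.2 → p ∈ t ∪ primesLE \ t := by
    intro p hp
    have hle : (p : ℕ) ≤ ⌊B⌋₊ := (p.2.dvd_mul.1 hp).elim
      (fun h => (Nat.le_of_dvd hx₁ h).trans hbox.1.2) fun h => (Nat.le_of_dvd hx₂ h).trans hbox.2.2
    rw [Finset.union_sdiff_self_eq_union, Finset.mem_union]
    exact .inr (Finset.mem_subtype.2 (Finset.mem_range.2 (Nat.lt_succ_of_le hle)))
  rw [sieveWeight_eq_prod A hx₁ hx₂ hmem, Finset.prod_union Finset.disjoint_sdiff]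
  have hlocal : ∀ p : Nat.Primes, localFactor A p x ∈ Set.Icc 0 1 := fun p =>
    localFactor_mem_Icc (Set.Icc_subset_Icc_right
      (inv_le_one_of_one_le₀ (by exact_mod_cast p.2.one_le)) (hA p)) x
  have hprod : ∀ v : Finset Nat.Primes, ∏ p ∈ v, localFactor A p x ∈ Set.Icc 0 1 := fun v =>
    ⟨Finset.prod_nonneg fun p _ => (hlocal p).1,
      Finset.prod_le_one (fun p _ => (hlocal p).1) fun p _ => (hlocal p).2⟩
  obtain ⟨hprod0, hprod1⟩ := hprod t
  have htail1 := (hprod (primesLE \ t)).2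
  constructor
  · nlinarith [one_sub_prod_le_sum_one_sub (primesLE \ t) hlocal]
  · exact mul_le_of_le_one_right hprod0 htail1

lemma abs_weightedSum_sieveWeight_sub_le
    (hA : ∀ p : Nat.Primes, A p ∈ Set.Icc 0 ((p : ℕ) : ℝ)⁻¹)
    (t : Finset Nat.Primes) {B : ℝ} (hB : 1 ≤ B) :
    |weightedSum (sieveWeight A) B - weightedSum (∏ p ∈ t, localFactor A p) B|
      ≤ (∑' p : {p // p ∉ t}, ((p : ℕ) : ℝ)⁻¹ ^ 2) * (3 * B * (1 + Real.log B) ^ 2) := by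
  obtain ⟨u, htu, hmem⟩ := exists_sieveWeight_mem_Icc hA t B
  have hupper : weightedSum (sieveWeight A) B ≤ weightedSum (∏ p ∈ t, localFactor A p) B :=
    weightedSum_mono fun x hx => by
      rw [Finset.prod_apply]
      exact (hmem x hx).2
  have hlower : weightedSum (∏ p ∈ t, localFactor A p) B
      ≤ weightedSum (sieveWeight A) B + ∑ p ∈ u, weightedSum (1 - localFactor A p) B := by
    rw [← weightedSum_sum, ← weightedSum_add]
    refine weightedSum_mono fun x hx => ?_
    simp only [Finset.prod_apply, Pi.add_apply, Finset.sum_apply, Pi.sub_apply, Pi.one_apply]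
    linarith [(hmem x hx).1]
  have htail : ∑ p ∈ u, ((p : ℕ) : ℝ)⁻¹ ^ 2 ≤ ∑' p : {p // p ∉ t}, ((p : ℕ) : ℝ)⁻¹ ^ 2 := by
    classical
    rw [← Finset.sum_subtype_of_mem _ fun p hp => Finset.disjoint_right.1 htu hp]
    exact ((summable_primes_inv_pow one_lt_two).subtype _).sum_le_tsum _ fun _ _ => by positivity
  have hsum : ∑ p ∈ u, weightedSum (1 - localFactor A p) B
      ≤ (∑' p : {p // p ∉ t}, ((p : ℕ) : ℝ)⁻¹ ^ 2) * (3 * B * (1 + Real.log B) ^ 2) :=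
    calc ∑ p ∈ u, weightedSum (1 - localFactor A p) B
        ≤ ∑ p ∈ u, ((p : ℕ) : ℝ)⁻¹ ^ 2 * (3 * B * (1 + Real.log B) ^ 2) :=
          Finset.sum_le_sum fun p _ => weightedSum_one_sub_localFactor_le p.2.pos (hA p) hB
      _ = (∑ p ∈ u, ((p : ℕ) : ℝ)⁻¹ ^ 2) * (3 * B * (1 + Real.log B) ^ 2) :=
          (Finset.sum_mul ..).symm
      _ ≤ _ := by gcongr
  rw [abs_sub_comm, abs_of_nonneg (sub_nonneg.2 hupper)]
  linarith

theorem hasDensity_sieveWeight (hA : ∀ p : Nat.Primes, A p ∈ Set.Icc 0 ((p : ℕ) : ℝ)⁻¹)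
    {E : ℝ} (hE : HasProd (fun p : Nat.Primes => localMean A p) E) :
    HasDensity (sieveWeight A) (1 / 12 * E) := by
  refine TendstoUniformlyOnFilter.tendsto_of_eventually_tendsto (p := atTop)
    (F := fun (t : Finset Nat.Primes) (B : ℝ) =>
      weightedSum (∏ p ∈ t, localFactor A p) B / (B * Real.log B ^ 2)) ?_
    (.of_forall fun t => hasDensity_prod_localFactor A t) (hE.const_mul (1 / 12))
  rw [Metric.tendstoUniformlyOnFilter_iff]
  intro ε hε
  have htail : ∀ᶠ t : Finset Nat.Primes in atTop,
      (∑' p : {p // p ∉ t}, ((p : ℕ) : ℝ)⁻¹ ^ 2) * 12 < ε := by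
    have h := (tendsto_tsum_compl_atTop_zero
      fun p : Nat.Primes => ((p : ℕ) : ℝ)⁻¹ ^ 2).mul_const 12
    rw [zero_mul] at h
    exact h.eventually_lt_const hε
  filter_upwards [htail.prod_mk (eventually_ge_atTop (Real.exp 1))] with ⟨t, B⟩ ⟨ht, hB⟩
  have hB0 : 0 < B := (Real.exp_pos 1).trans_le hB
  have hlog : 1 ≤ Real.log B := (Real.le_log_iff_exp_le hB0).2 hB
  have hmain : 0 < B * Real.log B ^ 2 := by positivity
  have htail_nonneg : 0 ≤ ∑' p : {p // p ∉ t}, ((p : ℕ) : ℝ)⁻¹ ^ 2 :=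
    tsum_nonneg fun _ => by positivity
  refine lt_of_le_of_lt ?_ ht
  rw [Real.dist_eq, ← sub_div, abs_div, abs_of_pos hmain, div_le_iff₀ hmain]
  calc |weightedSum (sieveWeight A) B - weightedSum (∏ p ∈ t, localFactor A p) B|
      ≤ (∑' p : {p // p ∉ t}, ((p : ℕ) : ℝ)⁻¹ ^ 2) * (3 * B * (1 + Real.log B) ^ 2) :=
        abs_weightedSum_sieveWeight_sub_le hA t ((Real.one_le_exp zero_le_one).trans hB)
    _ ≤ (∑' p : {p // p ∉ t}, ((p : ℕ) : ℝ)⁻¹ ^ 2) * (3 * B * (2 * Real.log B) ^ 2) := by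
        gcongr
        linarith
    _ = _ := by ring

end Sieve

/-! ### From subrings to weighted sums -/

lemma sum_divisorsAntidiagonal_eq_sum_sum {β : Type*} [AddCommMonoid β] (M : ℕ) (g : ℕ × ℕ → β) :
    ∑ n ∈ Finset.Icc 1 M, ∑ x ∈ n.divisorsAntidiagonal, g x
      = ∑ d ∈ Finset.Icc 1 M, ∑ a ∈ Finset.Icc 1 (M / d), g (a, d) := by
  rw [Finset.sum_sigma', Finset.sum_sigma']
  refine Finset.sum_nbij' (fun y => ⟨y.2.2, y.2.1⟩) (fun y => ⟨y.2 * y.1, (y.2, y.1)⟩)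
    ?_ ?_ ?_ (fun _ _ => rfl) fun _ _ => rfl
  · rintro ⟨n, a, d⟩ h
    simp only [Finset.mem_sigma, Finset.mem_Icc, Nat.mem_divisorsAntidiagonal] at h ⊢
    obtain ⟨⟨hn, hnM⟩, rfl, hn0⟩ := h
    obtain ⟨ha, hd⟩ := mul_ne_zero_iff.1 hn0
    exact ⟨⟨hd.bot_lt, (Nat.le_mul_of_pos_left d ha.bot_lt).trans hnM⟩, ha.bot_lt,
      (Nat.le_div_iff_mul_le hd.bot_lt).2 hnM⟩
  · rintro ⟨d, a⟩ h
    simp only [Finset.mem_sigma, Finset.mem_Icc, Nat.mem_divisorsAntidiagonal] at h ⊢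
    obtain ⟨⟨hd, -⟩, ha, haM⟩ := h
    have hpos : 0 < a * d := Nat.mul_pos ha hd
    exact ⟨⟨hpos, (Nat.le_div_iff_mul_le hd).1 haM⟩, trivial, hpos.ne'⟩
  · rintro ⟨n, a, d⟩ h
    obtain ⟨-, rfl, -⟩ := by
      simpa only [Finset.mem_sigma, Nat.mem_divisorsAntidiagonal] using h
    rfl

lemma dvd_sq_iff_of_squarefree {r s a : ℕ} (hr : Squarefree r) (hs : 0 < s) :
    r * s ^ 2 ∣ a ^ 2 ↔ r * s ∣ a := by
  constructor
  · intro h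
    obtain ⟨k, rfl⟩ : s ∣ a := (Nat.pow_dvd_pow_iff two_ne_zero).1 ((dvd_mul_left _ _).trans h)
    rw [mul_pow, mul_comm] at h
    have hdvd : r ∣ k ^ 2 := Nat.dvd_of_mul_dvd_mul_left (pow_pos hs 2) h
    rw [mul_comm]
    exact Nat.mul_dvd_mul_left _ ((hr.dvd_pow_iff_dvd two_ne_zero).1 hdvd)
  · rintro ⟨k, rfl⟩
    exact ⟨r * k ^ 2, by ring⟩

lemma card_filter_dvd_sq {r s : ℕ} (hr : Squarefree r) (hs : 0 < s) (M : ℕ) :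
    (Finset.card {a ∈ Finset.Icc 1 (M / (r * s ^ 2)) | r * s ^ 2 ∣ a ^ 2})
      = M / (r ^ 2 * s ^ 3) := by
  simp only [dvd_sq_iff_of_squarefree hr hs]
  calc Finset.card {a ∈ Finset.Ioc 0 (M / (r * s ^ 2)) | r * s ∣ a}
      = M / (r * s ^ 2) / (r * s) := Nat.Ioc_filter_dvd_card_eq_div _ _
    _ = M / (r ^ 2 * s ^ 3) := by
        rw [Nat.div_div_eq_div_mul]
        ring_nf

lemma injOn_mul_sq_squarefree :
    Set.InjOn (fun x : ℕ × ℕ => x.1 * x.2 ^ 2) {x | Squarefree x.1 ∧ 0 < x.2} := by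
  rintro ⟨r, s⟩ ⟨hr, hs⟩ ⟨r', s'⟩ ⟨hr', hs'⟩ heq
  simp only at hr hs hr' hs' heq
  have hrs : r * s = r' * s' := Nat.dvd_antisymm
    (by rw [← dvd_sq_iff_of_squarefree hr hs, heq, dvd_sq_iff_of_squarefree hr' hs'])
    (by rw [← dvd_sq_iff_of_squarefree hr' hs', ← heq, dvd_sq_iff_of_squarefree hr hs])
  have hss : s = s' := by
    refine Nat.eq_of_mul_eq_mul_left (Nat.mul_pos hr.ne_zero.bot_lt hs) ?_
    calc r * s * s = r * s ^ 2 := by ring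
      _ = r' * s' ^ 2 := heq
      _ = r * s * s' := by rw [hrs]; ring
  subst hss
  rw [Nat.eq_of_mul_eq_mul_right hs hrs]

lemma sum_Icc_eq_sum_squarefree_mul_sq {β : Type*} [AddCommMonoid β] (M : ℕ) (g : ℕ → β) :
    ∑ d ∈ Finset.Icc 1 M, g d = ∑ x ∈ Finset.Icc 1 M ×ˢ Finset.Icc 1 M with
      Squarefree x.1 ∧ x.1 * x.2 ^ 2 ≤ M, g (x.1 * x.2 ^ 2) := by
  symm
  refine Finset.sum_nbij (fun x => x.1 * x.2 ^ 2) ?_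
    (injOn_mul_sq_squarefree.mono fun x hx => ?_) ?_ fun _ _ => rfl
  · rintro ⟨r, s⟩ hx
    simp only [Finset.mem_filter, Finset.mem_product, Finset.mem_Icc] at hx ⊢
    obtain ⟨⟨⟨hr, -⟩, hs, -⟩, -, hle⟩ := hx
    exact ⟨Nat.mul_pos hr (pow_pos hs 2), hle⟩
  · simp only [Finset.mem_coe, Finset.mem_filter, Finset.mem_product, Finset.mem_Icc] at hx
    exact ⟨hx.2.1, hx.1.2.1⟩
  · intro d hd
    obtain ⟨hd0, hdM⟩ := Finset.mem_Icc.1 hd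
    obtain ⟨r, s, hr, hs, hrs, hsq⟩ := Nat.sq_mul_squarefree_of_pos hd0
    rw [mul_comm] at hrs
    have hrM : r ≤ M := (Nat.le_of_dvd hd0 ⟨s ^ 2, hrs.symm⟩).trans hdM
    have hsM : s ≤ M := (Nat.le_of_dvd hd0 ⟨r * s, by rw [← hrs]; ring⟩).trans hdM
    refine ⟨(r, s), ?_, hrs⟩
    simp only [Finset.mem_coe, Finset.mem_filter, Finset.mem_product, Finset.mem_Icc]
    exact ⟨⟨⟨hr, hrM⟩, hs, hsM⟩, hsq, hrs.trans_le hdM⟩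

lemma weight_eq_mul_natCast_div (B : ℝ) (x : ℕ × ℕ) :
    weight B x = x.1 * x.2 ^ 2 * ((⌊B⌋₊ / (x.1 ^ 2 * x.2 ^ 3) : ℕ) : ℝ) := by
  rw [weight, ← Nat.floor_div_natCast]
  push_cast
  rfl

lemma weightedSum_sieveWeight_eq_sum (A : ℕ → ℝ) (B : ℝ) :
    weightedSum (sieveWeight A) B = ∑ x ∈ Finset.Icc 1 ⌊B⌋₊ ×ˢ Finset.Icc 1 ⌊B⌋₊ with
      Squarefree x.1 ∧ x.1 * x.2 ^ 2 ≤ ⌊B⌋₊, sieveWeight A x * weight B x := by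
  rw [weightedSum_eq_sum _ fun _ => mem_box_of_weight_ne_zero, Finset.sum_filter_of_ne]
  intro x _ hx
  obtain ⟨-, h₂, hB⟩ := weight_ne_zero_iff.1 (right_ne_zero_of_mul hx)
  refine ⟨by_contra fun hsq => left_ne_zero_of_mul hx (if_neg hsq), ?_⟩
  calc x.1 * x.2 ^ 2 ≤ x.1 ^ 2 * x.2 ^ 3 :=
        Nat.mul_le_mul (Nat.le_self_pow two_ne_zero _) (Nat.pow_le_pow_right h₂ (by norm_num))
    _ ≤ ⌊B⌋₊ := Nat.le_floor (by exact_mod_cast hB)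

lemma sum_divisorsAntidiagonal_eq_weightedSum {A v : ℕ → ℝ}
    (hv : ∀ d, v d = d * ∏ p ∈ d.primeFactors, (1 - A p)) (B : ℝ) :
    ∑ n ∈ Finset.Icc 1 ⌊B⌋₊, ∑ x ∈ n.divisorsAntidiagonal with x.2 ∣ x.1 ^ 2, v x.2
      = weightedSum (sieveWeight A) B := by
  simp only [Finset.sum_filter]
  rw [sum_divisorsAntidiagonal_eq_sum_sum, sum_Icc_eq_sum_squarefree_mul_sq,
    weightedSum_sieveWeight_eq_sum]
  refine Finset.sum_congr rfl fun x hx => ?_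
  simp only [Finset.mem_filter, Finset.mem_product, Finset.mem_Icc] at hx
  obtain ⟨⟨⟨hr, -⟩, hs, -⟩, hsq, -⟩ := hx
  have hprimes : (x.1 * x.2 ^ 2).primeFactors = (x.1 * x.2).primeFactors := by
    rw [Nat.primeFactors_mul (by omega) (by positivity), Nat.primeFactors_mul (by omega) (by omega),
      Nat.primeFactors_pow _ two_ne_zero]
  simp only [← Finset.sum_filter]
  rw [Finset.sum_const, card_filter_dvd_sq hsq hs, nsmul_eq_mul, hv, hprimes,
    sieveWeight, if_pos hsq, weight_eq_mul_natCast_div]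
  push_cast
  ring

lemma N_eq_weightedSum (B : ℝ) : (N B : ℝ) = weightedSum (sieveWeight 0) B := by
  rw [← sum_divisorsAntidiagonal_eq_weightedSum (v := fun d => (d : ℝ)) (by simp), N, Nat.cast_sum]
  refine Finset.sum_congr rfl fun n hn => ?_
  rw [a_eq_sum (by grind), Nat.cast_sum]

lemma NCyclic_eq_weightedSum (B : ℝ) :
    (NCyclic B : ℝ) = weightedSum (sieveWeight fun p => (p : ℝ)⁻¹) B := by
  have htotient : ∀ d : ℕ, (d.totient : ℝ) = d * ∏ p ∈ d.primeFactors, (1 - (p : ℝ)⁻¹) := by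
    intro d
    have h := congrArg (Rat.cast : ℚ → ℝ) (Nat.totient_eq_mul_prod_factors d)
    push_cast at h
    exact h
  rw [← sum_divisorsAntidiagonal_eq_weightedSum htotient, NCyclic, Nat.cast_sum]
  refine Finset.sum_congr rfl fun n hn => ?_
  rw [aCyclic_eq_sum (by grind), Nat.cast_sum]

/-! ### Euler products -/

lemma inv_mem_Ioo (p : Nat.Primes) : ((p : ℕ) : ℝ)⁻¹ ∈ Set.Ioo 0 1 :=
  ⟨inv_pos.2 (by exact_mod_cast p.2.pos), inv_lt_one_of_one_lt₀ (by exact_mod_cast p.2.one_lt)⟩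

lemma summable_eulerFactor_sub_one : Summable fun p => eulerFactor p - 1 := by
  have hsq := (summable_primes_inv_pow one_lt_two).mul_left (-3)
  have hcube := (summable_primes_inv_pow (k := 3) (by norm_num)).mul_left 2
  refine (hsq.add hcube).congr fun p => ?_
  rw [eulerFactor]
  ring

lemma multipliable_eulerFactor : Multipliable eulerFactor :=
  (Real.multipliable_one_add_of_summable summable_eulerFactor_sub_one).congr
    fun _ => add_sub_cancel _ _

lemma eulerFactor_pos (p : Nat.Primes) : 0 < eulerFactor p := by
  obtain ⟨hpos, hlt⟩ := inv_mem_Ioo p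
  have hfactor : eulerFactor p = (1 - ((p : ℕ) : ℝ)⁻¹) ^ 2 * (1 + 2 * ((p : ℕ) : ℝ)⁻¹) := by
    rw [eulerFactor]
    ring
  rw [hfactor]
  exact mul_pos (pow_pos (sub_pos.2 hlt) 2) (by linarith)

lemma tprod_eulerFactor_pos : 0 < ∏' p, eulerFactor p := by
  have hlog := Real.summable_log_one_add_of_summable summable_eulerFactor_sub_one
  simp only [add_sub_cancel] at hlog
  rw [← Real.rexp_tsum_eq_tprod eulerFactor_pos hlog]
  exact Real.exp_pos _

lemma hasProd_one_sub_inv_sq :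
    HasProd (fun p : Nat.Primes => 1 - ((p : ℕ) : ℝ)⁻¹ ^ 2) (riemannZeta 2).re⁻¹ := by
  have hreal : ((riemannZeta 2).re : ℂ) = riemannZeta 2 :=
    Complex.ext (Complex.ofReal_re _) (riemannZeta_im_eq_zero_of_one_lt one_lt_two).symm
  have h := (riemannZeta_eulerProduct_hasProd (s := 2) (by norm_num)).inv₀
    (riemannZeta_ne_zero_of_one_lt_re (by norm_num))
  rw [← Complex.isometry_ofReal.isEmbedding.isInducing.hasProd_iff (g := Complex.ofRealHom),
    Complex.ofRealHom_eq_coe, Complex.ofReal_inv, hreal]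
  refine h.congr_fun fun p => ?_
  simp [Complex.cpow_neg]

theorem tendsto_N_div :
    Tendsto (fun B : ℝ => (N B : ℝ) / (B * Real.log B ^ 2)) atTop
      (𝓝 (1 / 12 * (riemannZeta 2).re⁻¹)) := by
  simp only [N_eq_weightedSum]
  refine hasDensity_sieveWeight (fun p => ⟨le_rfl, (inv_mem_Ioo p).1.le⟩) ?_
  simpa [localMean] using hasProd_one_sub_inv_sq

theorem tendsto_NCyclic_div :
    Tendsto (fun B : ℝ => (NCyclic B : ℝ) / (B * Real.log B ^ 2)) atTop
      (𝓝 (1 / 12 * ∏' p, eulerFactor p)) := by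
  simp only [NCyclic_eq_weightedSum]
  refine hasDensity_sieveWeight (fun p => ⟨(inv_mem_Ioo p).1.le, le_rfl⟩) ?_
  refine multipliable_eulerFactor.hasProd.congr_fun fun p => ?_
  rw [localMean, eulerFactor]
  ring

end CocyclicSubrings

theorem corollary8 :
    -- the counts and the Euler product are well defined
    (∀ n : ℕ, 1 ≤ n → (CocyclicSubrings.subringsOfIndex n).Finite) ∧
    Multipliable CocyclicSubrings.eulerFactor ∧
    -- the number of cocyclic subrings of index at most `B`
    Asymptotics.IsEquivalent Filter.atTop
      (fun B : ℝ => (CocyclicSubrings.NCyclic B : ℝ))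
      (fun B : ℝ =>
        (1 / 12 * ∏' p : Nat.Primes, CocyclicSubrings.eulerFactor p) * B * Real.log B ^ 2) ∧
    -- the proportion of cocyclic subrings among all subrings (`ζ(2)` is real)
    Filter.Tendsto
      (fun B : ℝ => (CocyclicSubrings.NCyclic B : ℝ) / (CocyclicSubrings.N B : ℝ))
      Filter.atTop
      (nhds ((riemannZeta 2).re * ∏' p : Nat.Primes, CocyclicSubrings.eulerFactor p)) := by
  open CocyclicSubrings in
  have hE : 0 < ∏' p, eulerFactor p := tprod_eulerFactor_pos
  have hζ : 0 < (riemannZeta 2).re := riemannZeta_re_pos_of_one_lt one_lt_two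
  refine ⟨fun n hn => finite_subringsOfIndex (by omega), multipliable_eulerFactor, ?_, ?_⟩
  · have hone := tendsto_NCyclic_div.div_const (1 / 12 * ∏' p, eulerFactor p)
    rw [div_self (by positivity)] at hone
    refine Asymptotics.isEquivalent_of_tendsto_one (hone.congr fun B => ?_)
    rw [Pi.div_apply, div_div, mul_comm (B * _), ← mul_assoc]
  · have hratio := tendsto_NCyclic_div.div tendsto_N_div (by positivity)
    rw [mul_div_mul_left _ _ (by norm_num), div_inv_eq_mul, mul_comm] at hratio
    refine hratio.congr' ?_
    filter_upwards [Filter.eventually_gt_atTop 1] with B hB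
    have hlog : 0 < Real.log B := Real.log_pos hB
    exact div_div_div_cancel_right₀ (by positivity) _ _
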